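/- For $\kappa\in\mathbb{C}$ let \[ M_{\kappa,1/2}(z)=z\,e^{-z/2}\sum_{s=0}^{\infty}\frac{(1-\kappa)_s}{(2)_s\,s!}\,z^s ,\qquad z\in\mathbb{C}, \] be the Whittaker function with $\mu=\tfrac12$, where $(a)_s=a(a+1)\cdots(a+s-1)$, and let $M'_{\kappa,1/2}$ be its derivative with respect to $z$. A *positive root* of $M_{\kappa,1/2}$ (respectively of $M'_{\kappa,1/2}$) means a real number $r>0$ with $M_{\kappa,1/2}(ir)=0$ (respectively $M'_{\kappa,1/2}(ir)=0$). Put $\gamma_0=\Gamma_0=0$ and, for $j\ge 1$, \[ \gamma_{2j-1}=\text{the $j$-th positive root of } M'_{-i,1/2},\qquad \gamma_{2j}=\text{the $j$-th positive root of } M_{-i,1/2}, \] \[ \Gamma_{2j-1}=\text{the $j$-th positive root of } M'_{i,1/2},\qquad \Gamma_{2j}=\text{the $j$-th positive root of } M_{i,1/2}. \] Then all these roots exist (for each of the four functions there is a smallest positive root, and after each root obtained in this way there is a smallest larger one), the sequences $(\gamma_j)_{j\ge0}$ and $(\Gamma_j)_{j\ge0}$ are strictly increasing, and there is a constant $r_0>0$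 such that \[ \gamma_j+r_0<\Gamma_j\qquad\text{for all } j\ge 1 ; \] one can take $r_0=2.31$. In particular $\gamma_j<\Gamma_j$ for all $j\ge1$. -/

import Mathlib

open scoped Nat

noncomputable section

/-- Kummer's function `M(a, b, z) = ∑ₛ (a)ₛ / ((b)ₛ s!) zˢ`
(an entire function of `z` when `b` is not `0, -1, -2, …`). -/
def kummerM (a b z : ℂ) : ℂ :=
  ∑' s : ℕ, (ascPochhammer ℂ s).eval a / ((ascPochhammer ℂ s).eval b * (s ! : ℂ)) * z ^ s

/-- The Whittaker function
`M_{κ,μ}(z) = e^{-z/2} z^{1/2+μ} M(1/2 + μ - κ, 1 + 2μ, z)`. -/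
def whittakerM (κ μ z : ℂ) : ℂ :=
  Complex.exp (-z / 2) * z ^ (1 / 2 + μ) * kummerM (1 / 2 + μ - κ) (1 + 2 * μ) z

/-- The real numbers `r > a` at which `g(i r) = 0`. -/
def rootsAfter (g : ℂ → ℂ) (a : ℝ) : Set ℝ :=
  {r : ℝ | a < r ∧ g (Complex.I * r) = 0}

/-- The `j`-th positive root of `r ↦ g(i r)`: with the value `0` at `j = 0`, each next one is the
smallest root larger than the previous one. -/
def nthPosRoot (g : ℂ → ℂ) : ℕ → ℝ
  | 0 => 0
  | j + 1 => sInf (rootsAfter g (nthPosRoot g j))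

/-- The sequence with `0`-th term `0`, with `(2j-1)`-th term the `j`-th positive root of
`r ↦ M'_{κ,1/2}(i r)` and with `2j`-th term the `j`-th positive root of `r ↦ M_{κ,1/2}(i r)`
(here `′` is the derivative with respect to the complex argument). -/
def whittakerSeq (κ : ℂ) (k : ℕ) : ℝ :=
  if Even k then nthPosRoot (whittakerM κ (1 / 2)) (k / 2)
  else nthPosRoot (deriv (whittakerM κ (1 / 2))) ((k + 1) / 2)

/-- `γ_j`, the sequence of critical points and zeros of `M_{-i,1/2}`. -/
def gammaLower (j : ℕ) : ℝ := whittakerSeq (-Complex.I) j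

/-- `Γ_j`, the sequence of critical points and zeros of `M_{i,1/2}`. -/
def gammaUpper (j : ℕ) : ℝ := whittakerSeq Complex.I j

end

/-! On the axis `z = i r` with `κ = iε`, Whittaker's equation becomes the real Coulomb equation `u''
= -(1/4 - ε/r) u`, where `u = Im M` and `u(0) = 0`, `u'(0) = 1`. Its Prüfer angle `θ`, defined by
`tan θ = u/u'`, satisfies `θ' = cos² θ + (1/4 - ε/r) sin² θ`. The angle meets `kπ/2` exactly once
for each `k ≥ 1`: at a critical point if `k` is odd, at a zero if `k` is even. So both sequences
list the quarter turns of an angle: `x` for `ε = -1`, `y` for `ε = 1`.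

The gap has two sources. The potential for `ε = 1` is repulsive up to the turning point 4, so `y(4)
< π/2` (`prufer_angle_mem_Ioo`), while for `ε = -1` a Taylor polynomial gives `x(1.69) ≥ π/2`
(`pi_div_two_le_prufer_angle`). Since `1/4 - 1/r ≤ 1/4 ≤ 1/4 + 1/s` for all positive `r`, `s`,
comparison survives the shift by `4 - 1.69 = 2.31`: `y(s + 2.31) < x(s)` for `s ≥ 1.69`
(`prufer_comparison`). Evaluating at the quarter turns of `x` gives the gap. -/

/-! ### Power series and the Whittaker equation. -/

/-- The derivative of an exponentially dominated power series is the termwise derivative. -/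
theorem hasDerivAt_tsum_mul_pow {c : ℕ → ℂ} (hc : ∀ s, ‖c s‖ ≤ 1 / (s ! : ℝ)) (z : ℂ) :
    HasDerivAt (fun z : ℂ => ∑' s, c s * z ^ s) (∑' s, ((s + 1 : ℕ) * c (s + 1)) * z ^ s) z := by
  have hs : ∀ x : ℝ, Summable fun s : ℕ => 1 / (s ! : ℝ) * x ^ s := fun x => by
    simpa [div_eq_inv_mul] using Real.summable_pow_div_factorial x
  set R : ℝ := ‖z‖ + 1
  have hR : 0 ≤ R := by positivity
  have hu : Summable fun s : ℕ => (s : ℝ) * (1 / (s ! : ℝ)) * R ^ (s - 1) := by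
    rw [← summable_nat_add_iff 1]
    refine (hs R).congr fun s => ?_
    rw [Nat.factorial_succ]
    push_cast
    field_simp
  have key := hasDerivAt_tsum_of_isPreconnected (𝕜 := ℂ) (g := fun s z => c s * z ^ s)
    (g' := fun s z => c s * (s * z ^ (s - 1))) hu (t := Metric.ball 0 R) (y₀ := 0) (y := z)
    Metric.isOpen_ball (convex_ball _ _).isPreconnected
    (fun s y _ => (hasDerivAt_pow s y).const_mul (c s))
    (fun s y hy => by
      have hy' : ‖y‖ ≤ R := by simpa using (Metric.mem_ball.1 hy).le
      rw [norm_mul, norm_mul, norm_pow, Complex.norm_natCast]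
      calc ‖c s‖ * (s * ‖y‖ ^ (s - 1)) ≤ 1 / (s ! : ℝ) * (s * R ^ (s - 1)) := by
            gcongr
            exact hc s
        _ = _ := by ring)
    (by simp [R]; positivity)
    (by
      refine summable_of_ne_finset_zero (s := {0}) fun s hs => ?_
      simp at hs
      simp [hs])
    (by simp [R])
  refine key.congr_deriv ?_
  have hsum : Summable fun s : ℕ => c s * (s * z ^ (s - 1)) := by
    refine Summable.of_norm_bounded hu fun s => ?_
    rw [norm_mul, norm_mul, norm_pow, Complex.norm_natCast]
    calc ‖c s‖ * (s * ‖z‖ ^ (s - 1)) ≤ 1 / (s ! : ℝ) * (s * R ^ (s - 1)) := by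
          gcongr
          · exact hc s
          · simp [R]
      _ = _ := by ring
  rw [hsum.tsum_eq_zero_add]
  simp only [Nat.cast_zero, zero_mul, mul_zero, zero_add, Nat.add_sub_cancel]
  exact tsum_congr fun s => by ring

theorem summable_mul_pow {c : ℕ → ℂ} (hc : ∀ s, ‖c s‖ ≤ 1 / (s ! : ℝ)) (z : ℂ) :
    Summable fun s => c s * z ^ s := by
  have : Summable fun s : ℕ => 1 / (s ! : ℝ) * ‖z‖ ^ s := by
    simpa [div_eq_inv_mul] using Real.summable_pow_div_factorial ‖z‖
  refine Summable.of_norm_bounded this fun s => ?_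
  rw [norm_mul, norm_pow]
  gcongr
  exact hc s

/-- The bound `1/s!` survives termwise differentiation, so the series can be differentiated twice.
-/
theorem norm_shift_coeff_le {c : ℕ → ℂ} (hc : ∀ s, ‖c s‖ ≤ 1 / (s ! : ℝ)) (s : ℕ) :
    ‖((s + 1 : ℕ) : ℂ) * c (s + 1)‖ ≤ 1 / (s ! : ℝ) := by
  rw [norm_mul, Complex.norm_natCast]
  calc ((s + 1 : ℕ) : ℝ) * ‖c (s + 1)‖ ≤ ((s + 1 : ℕ) : ℝ) * (1 / ((s + 1)! : ℝ)) := by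
        gcongr
        exact hc _
    _ = _ := by
      rw [Nat.factorial_succ]
      push_cast
      field_simp

/-- The Taylor coefficients of `kummerM a 2`. -/
noncomputable def kummerCoeff (a : ℂ) (s : ℕ) : ℂ :=
  (ascPochhammer ℂ s).eval a / ((ascPochhammer ℂ s).eval 2 * (s ! : ℂ))

theorem ascPochhammer_eval_two_ne_zero (s : ℕ) : (ascPochhammer ℂ s).eval 2 ≠ 0 := by
  induction s with
  | zero => simp
  | succ s ih =>
    rw [ascPochhammer_succ_eval]
    refine mul_ne_zero ih ?_
    exact_mod_cast (by omega : 2 + s ≠ 0)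

theorem norm_kummerCoeff_le {a : ℂ} (ha : ‖a‖ ≤ 2) (s : ℕ) :
    ‖kummerCoeff a s‖ ≤ 1 / (s ! : ℝ) := by
  have h : ‖(ascPochhammer ℂ s).eval a‖ ≤ ‖(ascPochhammer ℂ s).eval 2‖ := by
    induction s with
    | zero => simp
    | succ s ih =>
      rw [ascPochhammer_succ_eval, ascPochhammer_succ_eval, norm_mul, norm_mul]
      gcongr
      calc ‖a + s‖ ≤ ‖a‖ + ‖(s : ℂ)‖ := norm_add_le _ _
        _ ≤ 2 + s := by
          rw [Complex.norm_natCast]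
          gcongr
        _ = ‖((2 + s : ℕ) : ℂ)‖ := by
          rw [Complex.norm_natCast]
          push_cast
          rfl
        _ = _ := by push_cast; rfl
  have h2 := norm_pos_iff.2 (ascPochhammer_eval_two_ne_zero s)
  rw [kummerCoeff, norm_div, norm_mul, Complex.norm_natCast, ← div_div]
  gcongr
  exact (div_le_one h2).2 h

/-- This recurrence is Kummer's equation read coefficient by coefficient. -/
theorem kummerCoeff_succ (a : ℂ) (s : ℕ) :
    ((s : ℂ) + 1) * (s + 2) * kummerCoeff a (s + 1) = (a + s) * kummerCoeff a s := by
  have h1 := ascPochhammer_eval_two_ne_zero s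
  have h2 : (2 + s : ℂ) ≠ 0 := by exact_mod_cast (by omega : 2 + s ≠ 0)
  have h3 : (s + 1 : ℂ) ≠ 0 := by exact_mod_cast (by omega : s + 1 ≠ 0)
  have h4 : (s ! : ℂ) ≠ 0 := by exact_mod_cast s.factorial_ne_zero
  rw [kummerCoeff, kummerCoeff, ascPochhammer_succ_eval, ascPochhammer_succ_eval,
    Nat.factorial_succ]
  push_cast
  field_simp
  ring

/-- `kummerM a 2` solves Kummer's equation. -/
theorem kummerM_two_equation {a : ℂ} (ha : ‖a‖ ≤ 2) : ∃ K₁ K₂ : ℂ → ℂ,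
    (∀ z, HasDerivAt (kummerM a 2) (K₁ z) z) ∧ (∀ z, HasDerivAt K₁ (K₂ z) z) ∧
    kummerM a 2 0 = 1 ∧ ∀ z, z * K₂ z + (2 - z) * K₁ z = a * kummerM a 2 z := by
  have hc := norm_kummerCoeff_le ha
  have hc1 := norm_shift_coeff_le hc
  have hc2 := norm_shift_coeff_le hc1
  refine ⟨_, _, hasDerivAt_tsum_mul_pow hc, hasDerivAt_tsum_mul_pow hc1, ?_, fun z => ?_⟩
  · rw [kummerM, tsum_eq_single 0]
    · simp
    · intro s hs
      simp [hs]
  have shift : ∀ {c : ℕ → ℂ}, (∀ s, ‖c s‖ ≤ 1 / (s ! : ℝ)) →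
      HasSum (fun s : ℕ => s * c s * z ^ s) (z * ∑' s, ((s + 1 : ℕ) * c (s + 1)) * z ^ s) := by
    intro c hc
    have := ((summable_mul_pow (norm_shift_coeff_le hc) z).hasSum).mul_left z
    rw [← hasSum_nat_add_iff' 1]
    simp only [Finset.range_one, Finset.sum_singleton, Nat.cast_zero, zero_mul, sub_zero]
    refine Eq.mp (congrArg (HasSum · _) (funext fun s => ?_)) this
    ring
  have h2 := shift hc1
  have h1 := shift hc
  have h1' := ((summable_mul_pow hc1 z).hasSum).mul_left 2
  have h0 := ((summable_mul_pow hc z).hasSum).mul_left a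
  have := (h2.add h1').sub h1
  have e : (z * ∑' s, ((s + 1 : ℕ) * (((s + 1 + 1 : ℕ) : ℂ) * kummerCoeff a (s + 1 + 1))) * z ^ s)
      + 2 * (∑' s, ((s + 1 : ℕ) * kummerCoeff a (s + 1)) * z ^ s)
      - z * (∑' s, ((s + 1 : ℕ) * kummerCoeff a (s + 1)) * z ^ s)
      = a * ∑' s, kummerCoeff a s * z ^ s := by
    refine this.unique ?_
    refine Eq.mp (congrArg (HasSum · _) (funext fun s => ?_)) h0
    have := kummerCoeff_succ a s
    push_cast
    linear_combination -z ^ s * this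
  rw [kummerM]
  change _ = a * ∑' s, kummerCoeff a s * z ^ s
  rw [← e, sub_mul, add_sub_assoc]
  rfl

/-- `M_{κ,1/2}` is entire, with `z M'' = (z / 4 - κ) M`, `M(0) = 0` and `M'(0) = 1`. -/
theorem whittakerM_half_equation {κ : ℂ} (hκ : ‖1 - κ‖ ≤ 2) : ∃ W₁ W₂ : ℂ → ℂ,
    (∀ z, HasDerivAt (whittakerM κ (1 / 2)) (W₁ z) z) ∧ (∀ z, HasDerivAt W₁ (W₂ z) z) ∧
    Continuous W₂ ∧ (∀ z, z * W₂ z = (z / 4 - κ) * whittakerM κ (1 / 2) z) ∧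
    whittakerM κ (1 / 2) 0 = 0 ∧ W₁ 0 = 1 := by
  obtain ⟨K₁, K₂, h1, h2, h0, hK⟩ := kummerM_two_equation hκ
  set K := kummerM (1 - κ) 2
  have hW : whittakerM κ (1 / 2) = fun z => Complex.exp (-z / 2) * z * K z := by
    funext z
    -- At `μ = 1/2` the complex power has exponent 1, so no branch cut remains.
    rw [whittakerM]
    norm_num
    exact Or.inl rfl
  have hE : ∀ z : ℂ, HasDerivAt (fun z : ℂ => Complex.exp (-z / 2))
      (Complex.exp (-z / 2) * (-1 / 2)) z := fun z =>
    (((hasDerivAt_id z).neg).div_const 2).cexp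
  have hKc : Continuous K := continuous_iff_continuousAt.2 fun z => (h1 z).continuousAt
  -- The factor `z` of `M` has been cancelled in the second derivative, which is therefore visibly
  -- continuous at 0.
  refine ⟨fun z => Complex.exp (-z / 2) * (K z - z * K z / 2 + z * K₁ z),
    fun z => Complex.exp (-z / 2) * (K z * (z / 4 - κ)), fun z => ?_, fun z => ?_, ?_, fun z => ?_,
    ?_, ?_⟩
  · rw [hW]
    refine (((hE z).mul (hasDerivAt_id' z)).mul (h1 z)).congr_deriv ?_
    simp only [Pi.mul_apply]
    ring
  · refine ((hE z).mul (((h1 z).sub (((hasDerivAt_id' z).mul (h1 z)).div_const 2)).add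
      ((hasDerivAt_id' z).mul (h2 z)))).congr_deriv ?_
    simp only [Pi.mul_apply, Pi.add_apply, Pi.sub_apply]
    linear_combination Complex.exp (-z / 2) * hK z
  · fun_prop
  · rw [hW]
    ring
  · rw [hW]
    simp
  · simp [h0]

/-! ### The real Coulomb equation and its Prüfer angle. -/

/-- The data of a real solution of `u'' = -(1/4 - ε/r) u` with `u(0) = 0`, `u'(0) = 1`,
smooth across the singular point `0`. -/
structure CoulombSolution (ε : ℝ) (u u₁ u₂ : ℝ → ℝ) : Prop where
  hasDerivAt : ∀ r, HasDerivAt u (u₁ r) r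
  hasDerivAt_deriv : ∀ r, HasDerivAt u₁ (u₂ r) r
  continuous_snd : Continuous u₂
  equation : ∀ r, r * u₂ r = -(r / 4 - ε) * u r
  zero : u 0 = 0
  deriv_zero : u₁ 0 = 1

namespace CoulombSolution

variable {ε : ℝ} {u u₁ u₂ : ℝ → ℝ}

theorem snd_eq (h : CoulombSolution ε u u₁ u₂) {r : ℝ} (hr : r ≠ 0) :
    u₂ r = -(1 / 4 - ε / r) * u r := by
  have := h.equation r
  field_simp
  linarith

theorem continuous (h : CoulombSolution ε u u₁ u₂) : Continuous u :=
  continuous_iff_continuousAt.2 fun r => (h.hasDerivAt r).continuousAt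

theorem continuous_deriv (h : CoulombSolution ε u u₁ u₂) : Continuous u₁ :=
  continuous_iff_continuousAt.2 fun r => (h.hasDerivAt_deriv r).continuousAt

theorem reflect (h : CoulombSolution ε u u₁ u₂) :
    CoulombSolution (-ε) (fun r => -u (-r)) (fun r => u₁ (-r)) (fun r => -u₂ (-r)) where
  hasDerivAt r := by
    exact ((h.hasDerivAt (-r)).comp r (hasDerivAt_neg r)).neg.congr_deriv (by ring)
  hasDerivAt_deriv r := by
    exact ((h.hasDerivAt_deriv (-r)).comp r (hasDerivAt_neg r)).congr_deriv (by ring)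
  continuous_snd := (h.continuous_snd.comp continuous_neg).neg
  equation r := by
    have := h.equation (-r)
    linarith
  zero := by simp [h.zero]
  deriv_zero := by simp [h.deriv_zero]

/-- A Grönwall argument: a zero of `E = u² + u₁²` at `r` propagates back to every `δ > 0`. The
growth constant blows up as `δ → 0`, so 0 itself is reached by continuity, against `E(0) = 1`. -/
theorem sq_add_sq_pos_of_nonneg (h : CoulombSolution ε u u₁ u₂) {r : ℝ} (hr : 0 ≤ r) :
    0 < u r ^ 2 + u₁ r ^ 2 := by
  by_contra hneg
  have hE0 : u r ^ 2 + u₁ r ^ 2 = 0 := le_antisymm (not_lt.1 hneg) (by positivity)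
  have hr0 : 0 < r := by
    refine hr.lt_of_ne fun e => ?_
    rw [← e, h.zero, h.deriv_zero] at hE0
    norm_num at hE0
  have hle : ∀ δ ∈ Set.Ioc 0 r, u δ ^ 2 + u₁ δ ^ 2 ≤ 0 := by
    intro δ hδ
    -- Here `E' = 2 u u₁ (3/4 + ε/x)` with `|2 u u₁| ≤ E`, and `K` bounds the last factor on `[δ,
    -- r]`.
    set K : ℝ := 2 + |ε| / δ
    have hd : ∀ x, HasDerivAt (fun x => (u x ^ 2 + u₁ x ^ 2) * Real.exp (K * x))
        ((2 * u x * u₁ x + 2 * u₁ x * u₂ x) * Real.exp (K * x)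
          + (u x ^ 2 + u₁ x ^ 2) * (Real.exp (K * x) * K)) x := fun x => by
      refine ((((h.hasDerivAt x).pow 2).add ((h.hasDerivAt_deriv x).pow 2)).mul
        (((hasDerivAt_id' x).const_mul K).exp)).congr_deriv ?_
      simp
    have mono : MonotoneOn (fun x => (u x ^ 2 + u₁ x ^ 2) * Real.exp (K * x)) (Set.Icc δ r) := by
      refine monotoneOn_of_deriv_nonneg (convex_Icc _ _)
        (fun x _ => (hd x).continuousAt.continuousWithinAt)
        (fun x _ => (hd x).differentiableAt.differentiableWithinAt) fun x hx => ?_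
      rw [interior_Icc] at hx
      have hx0 : 0 < x := hδ.1.trans hx.1
      rw [(hd x).deriv, h.snd_eq hx0.ne']
      have hq : |ε / x| ≤ |ε| / δ := by
        rw [abs_div, abs_of_pos hx0]
        exact div_le_div_of_nonneg_left (abs_nonneg _) hδ.1 hx.1.le
      have hb : |3 / 4 + ε / x| ≤ K := by
        refine (abs_add_le _ _).trans ?_
        rw [abs_of_pos (by norm_num : (0 : ℝ) < 3 / 4)]
        simp only [K]
        linarith
      have hprod : |2 * (u x * u₁ x)| ≤ u x ^ 2 + u₁ x ^ 2 := by
        rw [abs_le]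
        constructor <;> nlinarith [sq_nonneg (u x + u₁ x), sq_nonneg (u x - u₁ x)]
      have hm := mul_le_mul hprod hb (abs_nonneg _) (by positivity)
      rw [← abs_mul] at hm
      have hm' := (abs_le.1 hm).1
      have : 0 ≤ (2 * (u x * u₁ x)) * (3 / 4 + ε / x) + (u x ^ 2 + u₁ x ^ 2) * K := by linarith
      have := mul_nonneg this (Real.exp_pos (K * x)).le
      linarith
    have := mono ⟨le_rfl, hδ.2⟩ ⟨hδ.2, le_rfl⟩ hδ.2
    simp only [hE0, zero_mul] at this
    exact nonpos_of_mul_nonpos_left this (Real.exp_pos _)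
  have hcont : Continuous fun x => u x ^ 2 + u₁ x ^ 2 :=
    (h.continuous.pow 2).add (h.continuous_deriv.pow 2)
  have : u 0 ^ 2 + u₁ 0 ^ 2 ≤ 0 := by
    refine le_of_tendsto (hcont.continuousWithinAt (s := Set.Ioi 0) (x := 0)).tendsto ?_
    filter_upwards [Ioc_mem_nhdsGT hr0] with x hx using hle x hx
  rw [h.zero, h.deriv_zero] at this
  norm_num at this

theorem sq_add_sq_pos (h : CoulombSolution ε u u₁ u₂) (r : ℝ) : 0 < u r ^ 2 + u₁ r ^ 2 := by
  rcases le_total 0 r with hr | hr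
  · exact h.sq_add_sq_pos_of_nonneg hr
  · simpa using h.reflect.sq_add_sq_pos_of_nonneg (r := -r) (by linarith)

/-- Prüfer polar coordinates. -/
theorem exists_prufer (h : CoulombSolution ε u u₁ u₂) : ∃ θ R : ℝ → ℝ, Continuous θ ∧ θ 0 = 0 ∧
    (∀ r, 0 < R r) ∧ (∀ r, u r = R r * Real.sin (θ r)) ∧ (∀ r, u₁ r = R r * Real.cos (θ r)) ∧
    ∀ r, r ≠ 0 → HasDerivAt θ
      (Real.cos (θ r) ^ 2 + (1 / 4 - ε / r) * Real.sin (θ r) ^ 2) r := by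
  set Z : ℝ → ℂ := fun r => u₁ r + u r * Complex.I
  set Z₁ : ℝ → ℂ := fun r => u₂ r + u₁ r * Complex.I
  have hZ : ∀ r, HasDerivAt Z (Z₁ r) r := fun r =>
    (h.hasDerivAt_deriv r).ofReal_comp.add ((h.hasDerivAt r).ofReal_comp.mul_const _)
  have hre : ∀ r, (Z r).re = u₁ r := fun r => by simp [Z]
  have him : ∀ r, (Z r).im = u r := fun r => by simp [Z]
  have hre1 : ∀ r, (Z₁ r).re = u₂ r := fun r => by simp [Z₁]
  have him1 : ∀ r, (Z₁ r).im = u₁ r := fun r => by simp [Z₁]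
  have hne : ∀ r, Z r ≠ 0 := fun r e => by
    have := h.sq_add_sq_pos r
    rw [← hre, ← him, e] at this
    simp at this
  have hZc : Continuous Z := continuous_iff_continuousAt.2 fun r => (hZ r).continuousAt
  have hZ1c : Continuous Z₁ :=
    (Complex.continuous_ofReal.comp h.continuous_snd).add
      ((Complex.continuous_ofReal.comp h.continuous_deriv).mul continuous_const)
  have hq : Continuous fun r => Z₁ r / Z r := hZ1c.div hZc hne
  -- A global logarithm of `Z`: since `Z 0 = 1`, `Z = exp L`, and `θ = Im L` is continuous through
  -- the singular point.
  set L : ℝ → ℂ := fun r => ∫ t in (0 : ℝ)..r, Z₁ t / Z t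
  have hL : ∀ r, HasDerivAt L (Z₁ r / Z r) r := fun r => hq.integral_hasStrictDerivAt 0 r |>.hasDerivAt
  have hL0 : L 0 = 0 := by simp [L]
  have hconst : ∀ r, Z r * Complex.exp (-L r) = 1 := by
    intro r
    have hd : ∀ x, HasDerivAt (fun r => Z r * Complex.exp (-L r)) 0 x := fun x => by
      refine ((hZ x).mul (hL x).neg.cexp).congr_deriv ?_
      have := hne x
      field_simp
      ring
    have := is_const_of_deriv_eq_zero (fun x => (hd x).differentiableAt) (fun x => (hd x).deriv) r 0
    simpa [hL0, Z, h.zero, h.deriv_zero] using this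
  have hZL : ∀ r, Z r = Complex.exp (L r) := fun r => by
    have := hconst r
    rw [Complex.exp_neg] at this
    exact eq_of_mul_inv_eq_one this
  have hθ : ∀ r, HasDerivAt (fun r => (L r).im) (Z₁ r / Z r).im r := fun r =>
    (Complex.imCLM.hasFDerivAt.comp_hasDerivAt r (hL r))
  have hu : ∀ r, u r = Real.exp (L r).re * Real.sin (L r).im := fun r => by
    rw [← him, hZL, Complex.exp_im]
  have hu1 : ∀ r, u₁ r = Real.exp (L r).re * Real.cos (L r).im := fun r => by
    rw [← hre, hZL, Complex.exp_re]
  refine ⟨fun r => (L r).im, fun r => Real.exp (L r).re,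
    continuous_iff_continuousAt.2 fun r => (hθ r).continuousAt, by simp [hL0],
    fun r => Real.exp_pos _, hu, hu1, fun r hr => ?_⟩
  refine (hθ r).congr_deriv ?_
  rw [Complex.div_im, hre, him, hre1, him1, Complex.normSq_apply, hre, him, h.snd_eq hr, hu, hu1]
  have hR := (Real.exp_pos (L r).re).ne'
  have hsc := Real.sin_sq_add_cos_sq (L r).im
  have e : Real.exp (L r).re * Real.cos (L r).im * (Real.exp (L r).re * Real.cos (L r).im) +
      Real.exp (L r).re * Real.sin (L r).im * (Real.exp (L r).re * Real.sin (L r).im)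
      = Real.exp (L r).re ^ 2 := by
    linear_combination Real.exp (L r).re ^ 2 * hsc
  rw [e]
  field_simp
  ring

end CoulombSolution

/-! ### Reduction to the imaginary axis. -/

/-- On the imaginary axis the zeros of `M_{iε,1/2}` and of its derivative are those of a real
Coulomb function and of its derivative. -/
theorem exists_coulombSolution {ε : ℝ} (hε : ‖1 - ε * Complex.I‖ ≤ 2) : ∃ u u₁ u₂ : ℝ → ℝ,
    CoulombSolution ε u u₁ u₂ ∧
    (∀ r : ℝ, whittakerM (ε * Complex.I) (1 / 2) (Complex.I * r) = 0 ↔ u r = 0) ∧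
    (∀ r : ℝ, deriv (whittakerM (ε * Complex.I) (1 / 2)) (Complex.I * r) = 0 ↔ u₁ r = 0) := by
  obtain ⟨W₁, W₂, h1, h2, hc, hW, h0, h10⟩ := whittakerM_half_equation hε
  set W := whittakerM (ε * Complex.I) (1 / 2)
  have hI : ∀ r : ℝ, HasDerivAt (fun r : ℝ => Complex.I * (r : ℂ)) Complex.I r := fun r => by
    simpa using (Complex.ofRealCLM.hasDerivAt (x := r)).const_mul Complex.I
  have d1 : ∀ r : ℝ, HasDerivAt (fun r : ℝ => W (Complex.I * r)) (W₁ (Complex.I * r) * Complex.I) r :=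
    fun r => (h1 _).comp r (hI r)
  have d2 : ∀ r : ℝ, HasDerivAt (fun r : ℝ => W₁ (Complex.I * r))
      (W₂ (Complex.I * r) * Complex.I) r := fun r => (h2 _).comp r (hI r)
  have hEq : ∀ r : ℝ, (r : ℂ) * W₂ (Complex.I * r) = (r / 4 - ε) * W (Complex.I * r) := fun r => by
    have := hW (Complex.I * r)
    have hI := Complex.I_mul_I
    linear_combination (-Complex.I) * this +
      (r * W₂ (Complex.I * r) - (r / 4 - ε) * W (Complex.I * r)) * hI
  have hEre : ∀ r : ℝ, r * (W₂ (Complex.I * r)).re = (r / 4 - ε) * (W (Complex.I * r)).re :=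
    fun r => by simpa using congrArg Complex.re (hEq r)
  have hEim : ∀ r : ℝ, r * (W₂ (Complex.I * r)).im = (r / 4 - ε) * (W (Complex.I * r)).im :=
    fun r => by simpa using congrArg Complex.im (hEq r)
  have du : ∀ r : ℝ, HasDerivAt (fun r : ℝ => (W (Complex.I * r)).im) (W₁ (Complex.I * r)).re r :=
    fun r => (Complex.imCLM.hasFDerivAt.comp_hasDerivAt r (d1 r)).congr_deriv (by simp)
  have du1 : ∀ r : ℝ, HasDerivAt (fun r : ℝ => (W₁ (Complex.I * r)).re)
      (-(W₂ (Complex.I * r)).im) r :=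
    fun r => (Complex.reCLM.hasFDerivAt.comp_hasDerivAt r (d2 r)).congr_deriv (by simp)
  have dq : ∀ r : ℝ, HasDerivAt (fun r : ℝ => (W (Complex.I * r)).re) (-(W₁ (Complex.I * r)).im) r :=
    fun r => (Complex.reCLM.hasFDerivAt.comp_hasDerivAt r (d1 r)).congr_deriv (by simp)
  have dq1 : ∀ r : ℝ, HasDerivAt (fun r : ℝ => (W₁ (Complex.I * r)).im)
      (W₂ (Complex.I * r)).re r :=
    fun r => (Complex.imCLM.hasFDerivAt.comp_hasDerivAt r (d2 r)).congr_deriv (by simp)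
  have sol : CoulombSolution ε (fun r => (W (Complex.I * r)).im) (fun r => (W₁ (Complex.I * r)).re)
      (fun r => -(W₂ (Complex.I * r)).im) :=
    { hasDerivAt := du
      hasDerivAt_deriv := du1
      continuous_snd := by fun_prop
      equation := fun r => by linarith [hEim r]
      zero := by simp [h0]
      deriv_zero := by simp [h10] }
  -- The Wronskian of `Re W` and `Im W`, two solutions of one real equation. As `u` and `u₁` have no
  -- common zero, its vanishing makes the other component vanish wherever `u` (or `u₁`) does.
  have wronskian : ∀ r : ℝ, (W (Complex.I * r)).re * (W₁ (Complex.I * r)).re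
      + (W (Complex.I * r)).im * (W₁ (Complex.I * r)).im = 0 := by
    intro r
    have hd : ∀ x : ℝ, HasDerivAt (fun r : ℝ => (W (Complex.I * r)).re * (W₁ (Complex.I * r)).re
        + (W (Complex.I * r)).im * (W₁ (Complex.I * r)).im) 0 x := fun x => by
      refine (((dq x).mul (du1 x)).add ((du x).mul (dq1 x))).congr_deriv ?_
      rcases eq_or_ne x 0 with rfl | hx
      · simp [h0]
        ring
      · have e1 := hEre x
        have e2 := hEim x
        refine mul_left_cancel₀ hx ?_
        linear_combination (W (Complex.I * x)).im * e1 - (W (Complex.I * x)).re * e2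
    have := is_const_of_deriv_eq_zero (fun x => (hd x).differentiableAt) (fun x => (hd x).deriv) r 0
    simpa [h0] using this
  refine ⟨_, _, _, sol, fun r => ⟨fun e => by simp [e], fun e => ?_⟩, fun r => ?_⟩
  · have hp := sol.sq_add_sq_pos r
    have hw := wronskian r
    rw [e] at hp hw
    refine Complex.ext ?_ e
    rcases mul_eq_zero.1 (by linarith : (W (Complex.I * r)).re * (W₁ (Complex.I * r)).re = 0)
      with h | h
    · exact h
    · rw [h] at hp
      norm_num at hp
  · rw [(h1 _).deriv]
    refine ⟨fun e => by simp [e], fun e => ?_⟩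
    have hp := sol.sq_add_sq_pos r
    have hw := wronskian r
    rw [e] at hp hw
    refine Complex.ext e ?_
    rcases mul_eq_zero.1 (by linarith : (W (Complex.I * r)).im * (W₁ (Complex.I * r)).im = 0)
      with h | h
    · rw [h] at hp
      norm_num at hp
    · exact h
-- The two angles near the origin.
open Real

namespace CoulombSolution

/-- The Prüfer angle of a solution with `ε = 1` stays in the first quadrant up to the turning
point `4`. -/
theorem prufer_angle_mem_Ioo {u u₁ u₂ θ R : ℝ → ℝ} (h : CoulombSolution 1 u u₁ u₂)
    (hc : Continuous θ) (h0 : θ 0 = 0)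
    (hu : ∀ r, u r = R r * sin (θ r)) (hu1 : ∀ r, u₁ r = R r * cos (θ r)) :
    ∀ r ∈ Set.Ioc (0 : ℝ) 4, θ r ∈ Set.Ioo 0 (π / 2) := by
  have hd : ∀ r, HasDerivAt (fun r => u r * u₁ r) (u₁ r ^ 2 + u r * u₂ r) r := fun r =>
    ((h.hasDerivAt r).mul (h.hasDerivAt_deriv r)).congr_deriv (by ring)
  -- `(u u₁)' = u₁² + (1/r - 1/4) u²` is positive before the turning point, so `sin θ cos θ > 0` on
  -- `(0, 4]`.
  have hmono : StrictMonoOn (fun r => u r * u₁ r) (Set.Icc 0 4) := by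
    refine strictMonoOn_of_deriv_pos (convex_Icc _ _)
      (fun r _ => (hd r).continuousAt.continuousWithinAt) fun r hr => ?_
    rw [interior_Icc] at hr
    rw [(hd r).deriv, h.snd_eq hr.1.ne']
    have hQ : 0 < 1 / r - 1 / 4 := sub_pos.2 (one_div_lt_one_div_of_lt hr.1 hr.2)
    have hp := h.sq_add_sq_pos r
    rcases eq_or_ne (u r) 0 with e | e
    · rw [e] at hp ⊢
      linarith
    · have := mul_pos hQ (pow_pos (abs_pos.2 e) 2)
      rw [sq_abs] at this
      nlinarith [sq_nonneg (u₁ r)]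
  have hsc : ∀ r ∈ Set.Ioc (0 : ℝ) 4, 0 < R r ^ 2 * sin (θ r) * cos (θ r) := fun r hr => by
    have := hmono ⟨le_rfl, by norm_num⟩ ⟨hr.1.le, hr.2⟩ hr.1
    simp only [h.zero, zero_mul] at this
    rw [hu, hu1] at this
    linarith
  -- By the intermediate value theorem the angle cannot cross a nonzero `a` with `sin a cos a ≤ 0`;
  -- this is used for `±π/2`.
  have avoid : ∀ a : ℝ, a ≠ 0 → sin a * cos a ≤ 0 → ∀ r ∈ Set.Ioc (0 : ℝ) 4,
      a ∉ Set.uIcc 0 (θ r) := by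
    intro a ha hsa r hr hmem
    rw [← h0] at hmem
    obtain ⟨s, hs, rfl⟩ := intermediate_value_uIcc hc.continuousOn hmem
    rw [Set.uIcc_of_le hr.1.le] at hs
    have hs0 : 0 < s := hs.1.lt_of_ne fun e => ha (by rw [← e, h0])
    have := hsc s ⟨hs0, hs.2.trans hr.2⟩
    nlinarith [sq_nonneg (R s)]
  have hpi := pi_pos
  intro r hr
  refine ⟨?_, ?_⟩
  · by_contra hneg
    rw [not_lt] at hneg
    have hlt : -(π / 2) < θ r := by
      by_contra hle
      refine avoid (-(π / 2)) (by linarith) (by simp) r hr ?_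
      rw [Set.uIcc_of_ge hneg]
      exact ⟨not_lt.1 hle, by linarith⟩
    have h1 : sin (θ r) ≤ 0 := sin_nonpos_of_nonpos_of_neg_pi_le hneg (by linarith)
    have h2 : 0 ≤ cos (θ r) := cos_nonneg_of_mem_Icc ⟨hlt.le, by linarith⟩
    have := hsc r hr
    have := mul_nonneg (mul_nonneg (sq_nonneg (R r)) h2) (neg_nonneg.2 h1)
    linarith
  · by_contra hneg
    rw [not_lt] at hneg
    refine avoid (π / 2) (by linarith) (by simp) r hr ?_
    rw [Set.uIcc_of_le (by linarith)]
    exact ⟨by linarith, hneg⟩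

/-- The Prüfer angle of a solution with `ε = -1` has left the first quadrant at `1.69`. -/
theorem pi_div_two_le_prufer_angle {u u₁ u₂ θ R : ℝ → ℝ} (h : CoulombSolution (-1) u u₁ u₂)
    (h0 : θ 0 = 0) (hR : ∀ r, 0 < R r)
    (hu : ∀ r, u r = R r * sin (θ r)) (hu1 : ∀ r, u₁ r = R r * cos (θ r))
    (hmono : StrictMonoOn θ (Set.Ici 0)) : π / 2 ≤ θ 1.69 := by
  by_contra hlt
  rw [not_le] at hlt
  have hpi := pi_pos
  have hpos : ∀ r ∈ Set.Ioc (0 : ℝ) 1.69, 0 < u r ∧ 0 < u₁ r := fun r hr => by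
    have h1 : 0 < θ r := h0 ▸ hmono (Set.mem_Ici.2 le_rfl) (Set.mem_Ici.2 hr.1.le) hr.1
    have h2 : θ r ≤ θ 1.69 :=
      hmono.monotoneOn (Set.mem_Ici.2 hr.1.le) (Set.mem_Ici.2 (by norm_num)) hr.2
    rw [hu, hu1]
    exact ⟨mul_pos (hR r) (sin_pos_of_pos_of_lt_pi h1 (by linarith)),
      mul_pos (hR r) (cos_pos_of_mem_Ioo ⟨by linarith, by linarith⟩)⟩
  -- The degree 4 Taylor polynomial of `u` at 0. Its residual `p'' + (1/4 + 1/r) p = 5r³/288 +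
  -- r⁴/576` is positive, so `u₁ p - u p'` decreases from 0, whereas `p > 0 > p'` at 1.69 would make
  -- it positive there.
  set p : ℝ → ℝ := fun r => r - r ^ 2 / 2 + r ^ 3 / 24 + r ^ 4 / 144
  set p₁ : ℝ → ℝ := fun r => 1 - r + r ^ 2 / 8 + r ^ 3 / 36
  set p₂ : ℝ → ℝ := fun r => -1 + r / 4 + r ^ 2 / 12
  have hp : ∀ r, HasDerivAt p (p₁ r) r := fun r => by
    refine ((((hasDerivAt_id' r).sub ((hasDerivAt_pow 2 r).div_const 2)).add
      ((hasDerivAt_pow 3 r).div_const 24)).add ((hasDerivAt_pow 4 r).div_const 144)).congr_deriv ?_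
    simp only [p₁]
    norm_num
    ring
  have hp1 : ∀ r, HasDerivAt p₁ (p₂ r) r := fun r => by
    refine ((((hasDerivAt_const r (1 : ℝ)).sub (hasDerivAt_id' r)).add
      ((hasDerivAt_pow 2 r).div_const 8)).add ((hasDerivAt_pow 3 r).div_const 36)).congr_deriv ?_
    simp only [p₂]
    norm_num
    ring
  have hd : ∀ r, HasDerivAt (fun r => u₁ r * p r - u r * p₁ r) (u₂ r * p r - u r * p₂ r) r :=
    fun r => (((h.hasDerivAt_deriv r).mul (hp r)).sub
      ((h.hasDerivAt r).mul (hp1 r))).congr_deriv (by ring)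
  have hanti : AntitoneOn (fun r => u₁ r * p r - u r * p₁ r) (Set.Icc 0 1.69) := by
    refine antitoneOn_of_deriv_nonpos (convex_Icc _ _)
      (fun r _ => (hd r).continuousAt.continuousWithinAt)
      (fun r _ => (hd r).differentiableAt.differentiableWithinAt) fun r hr => ?_
    rw [interior_Icc] at hr
    have hr0 := hr.1
    rw [(hd r).deriv, h.snd_eq hr0.ne']
    have e : -(1 / 4 - -1 / r) * u r * p r - u r * p₂ r
        = -(u r * (5 * r ^ 3 / 288 + r ^ 4 / 576)) := by
      simp only [p, p₂]
      field_simp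
      ring
    rw [e]
    have := (hpos r ⟨hr.1, hr.2.le⟩).1
    have : 0 ≤ u r * (5 * r ^ 3 / 288 + r ^ 4 / 576) := by positivity
    linarith
  have hfin := hanti ⟨le_rfl, by norm_num⟩ ⟨by norm_num, le_rfl⟩ (by norm_num : (0 : ℝ) ≤ 1.69)
  obtain ⟨hu, hu1⟩ := hpos 1.69 ⟨by norm_num, le_rfl⟩
  have hpp : 0 < p 1.69 := by norm_num [p]
  have hpn : p₁ 1.69 < 0 := by norm_num [p₁]
  have hp0 : p 0 = 0 := by norm_num [p]
  simp only [h.zero, hp0, mul_zero, zero_mul, sub_zero] at hfin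
  have := mul_pos hu1 hpp
  have := mul_pos hu (neg_pos.2 hpn)
  linarith

end CoulombSolution

/-! ### From an angle to the sequences of roots. -/

/-- An angle whose derivative is at least `m > 0` beyond `b` is unbounded. -/
theorem exists_le_of_deriv_ge {θ θ' : ℝ → ℝ} {b m : ℝ} (hm : 0 < m)
    (hc : Continuous θ) (hd : ∀ r, b < r → HasDerivAt θ (θ' r) r) (hge : ∀ r, b < r → m ≤ θ' r)
    (B : ℝ) : ∃ r, b ≤ r ∧ B ≤ θ r := by
  refine ⟨b + |B - θ b| / m, by have := div_nonneg (abs_nonneg (B - θ b)) hm.le; linarith, ?_⟩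
  have := (convex_Ici b).mul_sub_le_image_sub_of_le_deriv (f := θ) (C := m) hc.continuousOn
    (fun r hr => by
      rw [interior_Ici] at hr
      exact (hd r hr).differentiableAt.differentiableWithinAt)
    (fun r hr => by
      rw [interior_Ici] at hr
      rw [(hd r hr).deriv]
      exact hge r hr)
    b (Set.mem_Ici.2 le_rfl) (b + |B - θ b| / m)
    (Set.mem_Ici.2 (by have := div_nonneg (abs_nonneg (B - θ b)) hm.le; linarith))
    (by have := div_nonneg (abs_nonneg (B - θ b)) hm.le; linarith)
  have e : m * (b + |B - θ b| / m - b) = |B - θ b| := by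
    field_simp
    ring
  rw [e] at this
  linarith [le_abs_self (B - θ b)]

theorem strictMonoOn_Ici_of_hasDerivAt_pos {θ θ' : ℝ → ℝ} {b : ℝ}
    (hc : Continuous θ) (hd : ∀ r, b < r → HasDerivAt θ (θ' r) r) (hpos : ∀ r, b < r → 0 < θ' r) :
    StrictMonoOn θ (Set.Ici b) := by
  refine strictMonoOn_of_deriv_pos (convex_Ici b) hc.continuousOn fun r hr => ?_
  rw [interior_Ici] at hr
  rw [(hd r hr).deriv]
  exact hpos r hr

/-- The Prüfer rate is a weighted mean of 1 and `q`. -/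
theorem le_prufer_rate {m q x : ℝ} (hm : m ≤ 1) (hq : m ≤ q) :
    m ≤ cos x ^ 2 + q * sin x ^ 2 := by
  have h := sin_sq_add_cos_sq x
  nlinarith [mul_nonneg (sub_nonneg.2 hq) (sq_nonneg (sin x)),
    mul_nonneg (sub_nonneg.2 hm) (sq_nonneg (cos x))]

/-- The points at which an angle takes the values `k π / 2`. -/
structure IsQuarterTurnSeq (θ : ℝ → ℝ) (T : ℕ → ℝ) : Prop where
  strictMono : StrictMono T
  zero : T 0 = 0
  angle : ∀ k, 1 ≤ k → θ (T k) = k * (π / 2)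
  eq_of_angle : ∀ r k, 0 < r → 1 ≤ k → θ r = (k : ℕ) * (π / 2) → r = T k
  angle_pos : ∀ r, 0 < r → 0 < θ r

/-- Monotonicity is needed only beyond `a`, since the first quadrant contains no quarter turn. It is
used with `a = 0` for `ε = -1` and with the turning point `a = 4` for `ε = 1`. -/
theorem exists_isQuarterTurnSeq {θ : ℝ → ℝ} {a : ℝ} (ha : 0 ≤ a) (hc : Continuous θ)
    (hmono : StrictMonoOn θ (Set.Ici a)) (hlt : θ a < π / 2) (h0 : 0 ≤ θ a)
    (hsmall : ∀ r ∈ Set.Ioc 0 a, θ r ∈ Set.Ioo 0 (π / 2)) (hunb : ∀ B, ∃ r, a ≤ r ∧ B ≤ θ r) :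
    ∃ T, IsQuarterTurnSeq θ T ∧ ∀ k, 1 ≤ k → a < T k := by
  have hpi := pi_pos
  have hge : ∀ k : ℕ, 1 ≤ k → π / 2 ≤ k * (π / 2) := fun k hk => by
    have : (1 : ℝ) ≤ k := by exact_mod_cast hk
    nlinarith
  have hex : ∀ k : ℕ, 1 ≤ k → ∃ r, a < r ∧ θ r = k * (π / 2) := fun k hk => by
    obtain ⟨b, hab, hb⟩ := hunb (k * (π / 2))
    obtain ⟨r, hr, hrk⟩ := intermediate_value_Icc hab hc.continuousOn
      ⟨hlt.le.trans (hge k hk), hb⟩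
    refine ⟨r, hr.1.lt_of_ne ?_, hrk⟩
    rintro rfl
    linarith [hge k hk]
  choose! S hSa hS using hex
  refine ⟨fun k => if k = 0 then 0 else S k, ⟨?_, by simp, ?_, ?_, ?_⟩, ?_⟩
  · refine strictMono_nat_of_lt_succ fun k => ?_
    rcases Nat.eq_zero_or_pos k with rfl | hk
    · simpa using ha.trans_lt (hSa 1 le_rfl)
    · simp only [hk.ne', if_false, Nat.succ_ne_zero]
      refine (hmono.lt_iff_lt (Set.mem_Ici.2 (hSa k hk).le)
        (Set.mem_Ici.2 (hSa (k + 1) (by omega)).le)).1 ?_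
      rw [hS k hk, hS (k + 1) (by omega)]
      push_cast
      linarith
  · intro k hk
    simp only [Nat.one_le_iff_ne_zero.1 hk, if_false]
    exact hS k hk
  · intro r k hr hk hrk
    simp only [Nat.one_le_iff_ne_zero.1 hk, if_false]
    have har : a < r := by
      by_contra hle
      have := (hsmall r ⟨hr, not_lt.1 hle⟩).2
      linarith [hge k hk]
    exact hmono.injOn (Set.mem_Ici.2 har.le) (Set.mem_Ici.2 (hSa k hk).le) (hrk.trans (hS k hk).symm)
  · intro r hr
    rcases le_or_gt r a with h | h
    · exact (hsmall r ⟨hr, h⟩).1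
    · exact h0.trans_lt (hmono (Set.mem_Ici.2 le_rfl) (Set.mem_Ici.2 h.le) h)
  · intro k hk
    simp only [Nat.one_le_iff_ne_zero.1 hk, if_false]
    exact hSa k hk

namespace IsQuarterTurnSeq

variable {θ : ℝ → ℝ} {T : ℕ → ℝ}

theorem pos (h : IsQuarterTurnSeq θ T) {k : ℕ} (hk : 1 ≤ k) : 0 < T k :=
  h.zero ▸ h.strictMono hk

theorem sin_eq_zero_iff (h : IsQuarterTurnSeq θ T) {r : ℝ} (hr : 0 < r) :
    sin (θ r) = 0 ↔ ∃ j, 1 ≤ j ∧ r = T (2 * j) := by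
  constructor
  · intro hs
    obtain ⟨n, hn⟩ := Real.sin_eq_zero_iff.1 hs
    have hθ := h.angle_pos r hr
    have hn0 : 0 < n := by
      by_contra hle
      have : (n : ℝ) ≤ 0 := by exact_mod_cast not_lt.1 hle
      nlinarith [pi_pos]
    lift n to ℕ using hn0.le
    refine ⟨n, by omega, h.eq_of_angle r _ hr (by omega) ?_⟩
    rw [← hn]
    push_cast
    ring
  · rintro ⟨j, hj, rfl⟩
    rw [h.angle _ (by omega)]
    refine Real.sin_eq_zero_iff.2 ⟨j, ?_⟩
    push_cast
    ring

theorem cos_eq_zero_iff (h : IsQuarterTurnSeq θ T) {r : ℝ} (hr : 0 < r) :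
    cos (θ r) = 0 ↔ ∃ j, 1 ≤ j ∧ r = T (2 * j - 1) := by
  constructor
  · intro hs
    obtain ⟨n, hn⟩ := Real.cos_eq_zero_iff.1 hs
    have hθ := h.angle_pos r hr
    have hn0 : -1 < n := by
      by_contra hle
      have : (n : ℝ) ≤ -1 := by exact_mod_cast not_lt.1 hle
      nlinarith [pi_pos]
    lift n to ℕ using (by omega)
    refine ⟨n + 1, by omega, h.eq_of_angle r _ hr (by omega) ?_⟩
    rw [hn, show 2 * (n + 1) - 1 = 2 * n + 1 by omega]
    push_cast
    ring
  · rintro ⟨j, hj, rfl⟩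
    obtain ⟨i, rfl⟩ : ∃ i, j = i + 1 := ⟨j - 1, by omega⟩
    rw [h.angle _ (by omega)]
    refine Real.cos_eq_zero_iff.2 ⟨i, ?_⟩
    rw [show 2 * (i + 1) - 1 = 2 * i + 1 by omega]
    push_cast
    ring

end IsQuarterTurnSeq

theorem isLeast_rootsAfter {g : ℂ → ℂ} {S : ℕ → ℝ} (hS : StrictMono S) (h0 : S 0 = 0)
    (hg : ∀ r : ℝ, 0 < r → (g (Complex.I * r) = 0 ↔ ∃ j, 1 ≤ j ∧ r = S j)) (j : ℕ) :
    IsLeast (rootsAfter g (S j)) (S (j + 1)) := by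
  have hnn : 0 ≤ S j := h0 ▸ hS.monotone (Nat.zero_le j)
  have hlt := hS (Nat.lt_succ_self j)
  refine ⟨⟨hlt, (hg _ (hnn.trans_lt hlt)).2 ⟨j + 1, by omega, rfl⟩⟩, fun r hr => ?_⟩
  obtain ⟨i, -, rfl⟩ := (hg r (hnn.trans_lt hr.1)).1 hr.2
  exact hS.monotone (hS.lt_iff_lt.1 hr.1)

theorem nthPosRoot_eq {g : ℂ → ℂ} {S : ℕ → ℝ} (hS : StrictMono S) (h0 : S 0 = 0)
    (hg : ∀ r : ℝ, 0 < r → (g (Complex.I * r) = 0 ↔ ∃ j, 1 ≤ j ∧ r = S j)) (j : ℕ) :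
    nthPosRoot g j = S j := by
  induction j with
  | zero => rw [nthPosRoot, h0]
  | succ j ih => rw [nthPosRoot, ih, (isLeast_rootsAfter hS h0 hg j).csInf_eq]

/-- If the zeros of `M_{κ,1/2}` and `M'_{κ,1/2}` on the positive imaginary axis are the even and
odd quarter turns of an angle, then these turns form `whittakerSeq κ`. -/
theorem whittakerSeq_eq_of_isQuarterTurnSeq {κ : ℂ} {θ : ℝ → ℝ} {T : ℕ → ℝ}
    (hT : IsQuarterTurnSeq θ T)
    (hM : ∀ r : ℝ, whittakerM κ (1 / 2) (Complex.I * r) = 0 ↔ sin (θ r) = 0)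
    (hM' : ∀ r : ℝ, deriv (whittakerM κ (1 / 2)) (Complex.I * r) = 0 ↔ cos (θ r) = 0) :
    (∀ j : ℕ,
      IsLeast (rootsAfter (whittakerM κ (1 / 2)) (nthPosRoot (whittakerM κ (1 / 2)) j))
        (nthPosRoot (whittakerM κ (1 / 2)) (j + 1)) ∧
      IsLeast
        (rootsAfter (deriv (whittakerM κ (1 / 2))) (nthPosRoot (deriv (whittakerM κ (1 / 2))) j))
        (nthPosRoot (deriv (whittakerM κ (1 / 2))) (j + 1))) ∧ whittakerSeq κ = T := by
  have s1 : StrictMono fun j => T (2 * j) := fun i j hij => hT.strictMono (by omega)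
  -- At `j = 0` truncated subtraction gives `T 0 = 0`, the starting value of `nthPosRoot`.
  have s2 : StrictMono fun j => T (2 * j - 1) := fun i j hij => hT.strictMono (by omega)
  have z1 : (fun j => T (2 * j)) 0 = 0 := hT.zero
  have z2 : (fun j => T (2 * j - 1)) 0 = 0 := hT.zero
  have g1 := fun (r : ℝ) (hr : 0 < r) => (hM r).trans (hT.sin_eq_zero_iff hr)
  have g2 := fun (r : ℝ) (hr : 0 < r) => (hM' r).trans (hT.cos_eq_zero_iff hr)
  have e1 := nthPosRoot_eq s1 z1 g1
  have e2 := nthPosRoot_eq s2 z2 g2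
  refine ⟨fun j => ⟨?_, ?_⟩, ?_⟩
  · rw [e1, e1]
    exact isLeast_rootsAfter s1 z1 g1 j
  · rw [e2, e2]
    exact isLeast_rootsAfter s2 z2 g2 j
  · funext k
    rw [whittakerSeq, e1, e2]
    split_ifs with hk
    · congr 1
      have := Nat.even_iff.1 hk
      omega
    · congr 1
      have := Nat.not_even_iff.1 hk
      omega

/-! ### Comparison and the uniform gap. -/

/-- Comparison of the Prüfer angles of two potentials `q ≤ 1/4 ≤ Q`. -/
theorem prufer_comparison {x y q Q : ℝ → ℝ} {a : ℝ} (hxc : Continuous x) (hyc : Continuous y)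
    (hx : ∀ s, a < s → HasDerivAt x (cos (x s) ^ 2 + Q s * sin (x s) ^ 2) s)
    (hy : ∀ s, a < s → HasDerivAt y (cos (y s) ^ 2 + q s * sin (y s) ^ 2) s)
    (hq0 : ∀ s, a < s → 0 ≤ q s) (hq1 : ∀ s, a < s → q s ≤ 1) (hqQ : ∀ s, a < s → q s ≤ Q s)
    (ha : y a < x a) : ∀ s, a ≤ s → y s < x s := by
  intro s₁ hs₁
  by_contra hneg
  have hcomp : IsCompact (Set.Icc a s₁ ∩ {s | x s ≤ y s}) :=
    isCompact_Icc.inter_right (isClosed_le hxc hyc)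
  -- `s` is the first point where `x ≤ y`.
  obtain ⟨s, ⟨hs, hsle⟩, hmin⟩ := hcomp.exists_isLeast ⟨s₁, ⟨hs₁, le_rfl⟩, not_lt.1 hneg⟩
  have hlt : ∀ t ∈ Set.Ico a s, y t < x t := fun t ht => by
    by_contra hle
    exact absurd (hmin ⟨⟨ht.1, ht.2.le.trans hs.2⟩, not_lt.1 hle⟩) (not_le.2 ht.2)
  have hd : ∀ t, a < t → HasDerivAt (fun t => (x t - y t) * exp t)
      (((cos (x t) ^ 2 + Q t * sin (x t) ^ 2) - (cos (y t) ^ 2 + q t * sin (y t) ^ 2)) * exp t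
        + (x t - y t) * exp t) t := fun t ht =>
    ((hx t ht).sub (hy t ht)).mul (Real.hasDerivAt_exp t)
  -- `x' - y' = (Q - q) sin² x - (1 - q)(sin² x - sin² y) ≥ -(x - y)`, because `sin²` is 1-Lipschitz
  -- and `0 ≤ 1 - q ≤ 1`. Hence `x - y` cannot reach 0.
  have hmono : MonotoneOn (fun t => (x t - y t) * exp t) (Set.Icc a s) := by
    refine monotoneOn_of_deriv_nonneg (convex_Icc _ _) (by fun_prop) (fun t ht => ?_)
      fun t ht => ?_
    · rw [interior_Icc] at ht
      exact (hd t ht.1).differentiableAt.differentiableWithinAt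
    · rw [interior_Icc] at ht
      rw [(hd t ht.1).deriv, ← add_mul]
      refine mul_nonneg ?_ (exp_pos t).le
      have hxy := hlt t ⟨ht.1.le, ht.2⟩
      have hlip : |sin (x t) ^ 2 - sin (y t) ^ 2| ≤ x t - y t := by
        have e : sin (x t) ^ 2 - sin (y t) ^ 2 = sin (x t + y t) * sin (x t - y t) := by
          rw [sin_add, sin_sub]
          have h1 := sin_sq_add_cos_sq (x t)
          have h2 := sin_sq_add_cos_sq (y t)
          linear_combination sin (y t) ^ 2 * h1 - sin (x t) ^ 2 * h2
        rw [e, abs_mul]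
        calc |sin (x t + y t)| * |sin (x t - y t)| ≤ 1 * |x t - y t| :=
              mul_le_mul (abs_sin_le_one _) (abs_sin_le_abs) (abs_nonneg _) zero_le_one
          _ = x t - y t := by rw [one_mul, abs_of_pos (sub_pos.2 hxy)]
      have h1 := sin_sq_add_cos_sq (x t)
      have h2 := sin_sq_add_cos_sq (y t)
      have h3 := mul_nonneg (sub_nonneg.2 (hqQ t ht.1)) (sq_nonneg (sin (x t)))
      have h4 : (1 - q t) * (sin (x t) ^ 2 - sin (y t) ^ 2) ≤ 1 * (x t - y t) := by
        refine (le_abs_self _).trans ?_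
        rw [abs_mul, abs_of_nonneg (sub_nonneg.2 (hq1 t ht.1))]
        exact mul_le_mul (by linarith [hq0 t ht.1]) hlip (abs_nonneg _) zero_le_one
      nlinarith
  have hge := hmono ⟨le_rfl, hs.1⟩ ⟨hs.1, le_rfl⟩ hs.1
  have h1 := mul_pos (sub_pos.2 ha) (exp_pos a)
  have h2 := mul_nonneg (sub_nonneg.2 (show x s ≤ y s from hsle)) (exp_pos s).le
  simp only at hge
  linarith

theorem mainTheorem7 :
    -- the `j`-th positive roots exist for every `j`, so that the two sequences are well defined
    (∀ κ : ℂ, κ = -Complex.I ∨ κ = Complex.I → ∀ j : ℕ,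
      IsLeast (rootsAfter (whittakerM κ (1 / 2)) (nthPosRoot (whittakerM κ (1 / 2)) j))
        (nthPosRoot (whittakerM κ (1 / 2)) (j + 1)) ∧
      IsLeast
        (rootsAfter (deriv (whittakerM κ (1 / 2))) (nthPosRoot (deriv (whittakerM κ (1 / 2))) j))
        (nthPosRoot (deriv (whittakerM κ (1 / 2))) (j + 1))) ∧
    -- the two sequences are increasing
    StrictMono gammaLower ∧ StrictMono gammaUpper ∧
    -- the uniform gap, with the explicit constant
    (∃ r₀ : ℝ, 0 < r₀ ∧ r₀ = 2.31 ∧ ∀ j : ℕ, 1 ≤ j → gammaLower j + r₀ < gammaUpper j) ∧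
    -- hence the strict ordering
    (∀ j : ℕ, 1 ≤ j → gammaLower j < gammaUpper j) := by
  obtain ⟨u, u₁, u₂, hu, huM, huM'⟩ := exists_coulombSolution (ε := -1)
    ((norm_sub_le _ _).trans (by norm_num))
  obtain ⟨v, v₁, v₂, hv, hvM, hvM'⟩ := exists_coulombSolution (ε := 1)
    ((norm_sub_le _ _).trans (by norm_num))
  rw [show ((-1 : ℝ) : ℂ) * Complex.I = -Complex.I by simp] at huM huM'
  rw [show ((1 : ℝ) : ℂ) * Complex.I = Complex.I by simp] at hvM hvM'
  obtain ⟨x, A, hxc, hx0, hA, hux, hux1, hxd⟩ := hu.exists_prufer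
  obtain ⟨y, B, hyc, hy0, hB, hvy, hvy1, hyd⟩ := hv.exists_prufer
  have hpi := pi_pos
  have hQ : ∀ r : ℝ, 0 < r → 1 / 4 ≤ 1 / 4 - -1 / r := fun r hr => by
    have := one_div_pos.2 hr
    rw [neg_div]
    linarith
  have hq : ∀ r : ℝ, 4 < r → 0 < 1 / 4 - 1 / r := fun r hr =>
    sub_pos.2 (one_div_lt_one_div_of_lt (by norm_num) hr)
  have hq4 : ∀ r : ℝ, 4 < r → 1 / 4 - 1 / r ≤ 1 / 4 := fun r hr => by
    have := one_div_pos.2 (by linarith : 0 < r)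
    linarith
  have hxmono : StrictMonoOn x (Set.Ici 0) :=
    strictMonoOn_Ici_of_hasDerivAt_pos hxc (fun r hr => hxd r hr.ne') fun r hr =>
      lt_of_lt_of_le (by norm_num) (le_prufer_rate (by norm_num) (hQ r hr))
  have hymono : StrictMonoOn y (Set.Ici 4) :=
    strictMonoOn_Ici_of_hasDerivAt_pos hyc (fun r hr => hyd r (by linarith)) fun r hr =>
      lt_of_lt_of_le (hq r hr) (le_prufer_rate (by linarith [hq4 r hr]) le_rfl)
  have hysmall := hv.prufer_angle_mem_Ioo hyc hy0 hvy hvy1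
  have hy4 := hysmall 4 ⟨by norm_num, le_rfl⟩
  obtain ⟨S, hS, -⟩ := exists_isQuarterTurnSeq le_rfl hxc hxmono (by rw [hx0]; positivity) hx0.ge
    (fun r hr => absurd hr.1 (not_lt.2 hr.2))
    (exists_le_of_deriv_ge (by norm_num : (0 : ℝ) < 1 / 4) hxc (fun r hr => hxd r hr.ne')
      fun r hr => le_prufer_rate (by norm_num) (hQ r hr))
  obtain ⟨T, hT, hT4⟩ := exists_isQuarterTurnSeq (by norm_num : (0 : ℝ) ≤ 4) hyc hymono hy4.2
    hy4.1.le hysmall fun b => by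
      -- The bound `1/4 - 1/r` degenerates at 4; beyond 8 it is at least 1/8.
      obtain ⟨r, hr, hb⟩ := exists_le_of_deriv_ge (b := 8) (by norm_num : (0 : ℝ) < 1 / 8) hyc
        (fun r hr => hyd r (by linarith)) (fun r hr => le_prufer_rate (by norm_num) (by
          have := one_div_lt_one_div_of_lt (by norm_num) hr
          linarith)) b
      exact ⟨r, by linarith, hb⟩
  obtain ⟨rootsU, seqU⟩ := whittakerSeq_eq_of_isQuarterTurnSeq hS
    (fun r => (huM r).trans (by rw [hux]; simp [(hA r).ne']))
    (fun r => (huM' r).trans (by rw [hux1]; simp [(hA r).ne']))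
  obtain ⟨rootsV, seqV⟩ := whittakerSeq_eq_of_isQuarterTurnSeq hT
    (fun r => (hvM r).trans (by rw [hvy]; simp [(hB r).ne']))
    (fun r => (hvM' r).trans (by rw [hvy1]; simp [(hB r).ne']))
  have hlow : gammaLower = S := seqU
  have hupp : gammaUpper = T := seqV
  -- The shift aligns 1.69 with the turning point 4, beyond which `q` is nonnegative.
  have hcomp : ∀ s, 1.69 ≤ s → y (s + 2.31) < x s := by
    refine prufer_comparison (y := fun s => y (s + 2.31)) (Q := fun s => 1 / 4 - -1 / s)
      (q := fun s => 1 / 4 - 1 / (s + 2.31)) hxc (by fun_prop)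
      (fun s hs => hxd s (by linarith)) (fun s hs => ?_) (fun s hs => (hq _ (by linarith)).le)
      (fun s hs => (hq4 _ (by linarith)).trans (by norm_num))
      (fun s hs => (hq4 _ (by linarith)).trans (hQ s (by linarith))) ?_
    · exact (hyd (s + 2.31) (by linarith)).comp_add_const s 2.31
    · have := hu.pi_div_two_le_prufer_angle hx0 hA hux hux1 hxmono
      norm_num at this ⊢
      linarith [hy4.2]
  have hgap : ∀ j : ℕ, 1 ≤ j → S j + 2.31 < T j := fun j hj => by
    have h4 := hT4 j hj
    -- Before 1.69 comparison is unavailable, but then `S j + 2.31 < 4 < T j`.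
    rcases lt_or_ge (S j) 1.69 with h | h
    · linarith
    · have := hcomp _ h
      rw [hS.angle j hj, ← hT.angle j hj] at this
      exact (hymono.lt_iff_lt (Set.mem_Ici.2 (by linarith)) (Set.mem_Ici.2 h4.le)).1 this
  rw [hlow, hupp]
  refine ⟨?_, hS.strictMono, hT.strictMono, ⟨2.31, by norm_num, rfl, hgap⟩, fun j hj => ?_⟩
  · rintro κ (rfl | rfl)
    · exact rootsU
    · exact rootsV
  · linarith [hgap j hj]
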